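/- Let $N\ge 1$ and let $X=(X_1,\dots,X_N)$ be random variables (the sensor data), $X_k$ taking values in a measurable space $E_k$. For each configuration $B\in\mathcal B:=\{0,1\}^N$ let $\hat X=\hat X^{B}=(\hat X_1,\dots,\hat X_N)$ be an estimate of $X$ that is a measurable function of the data $(X_i)_{i:B_i=1}$ of the active sensors, and let real-valued distortions $d_B(X_k,\hat X_k)$ be given that are integrable. Put $\mathbb E d_B(X,\hat X)=\sum_{k=1}^N\mathbb E d_B(X_k,\hat X_k)$ and, for $\lambda\in\mathbb R$, $h(B)=\mathbb E d_B(X,\hat X)+\lambda\|B\|_1$. Let $\Delta=\max_{A,B\in\mathcal B}|h(B)-h(A)|$, let $\beta_0>0$ satisfy $\beta_0N\Delta<1$, and put $\beta(t)=\beta_0\log(1+t)$. Consider the time-inhomogeneous Markov chain $\{B(t)\}_{t\ge0}$ on $\mathcal B$ with arbitrary initial $B(0)$ in which, for each $t\ge1$, $B(t)$ is obtained from $B(t-1)$ as follows: choose a sensor $j\in\{1,\dots,N\}$ uniformly at random, independently of the past; set $B_j(t)=1$ with probability $$\frac{e^{-\beta(t)h(B_{-j}(t-1),1)}}{e^{-\beta(t)h(B_{-j}(t-1),1)}+e^{-\beta(t)h(B_{-j}(t-1),0)}}$$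 and $B_j(t)=0$ otherwise, where $(B_{-j},a)$ denotes $B$ with its $j$-th entry replaced by $a$; and leave all other entries unchanged. Let $P(m;n)$ be its transition matrix from time $m$ to time $n$, let $\mathcal D$ be the set of probability distributions on $\mathcal B$, and let $d_V$ be the total variation distance. Then the chain is strongly ergodic: there is $\pi\in\mathcal D$ such that, for all $m\ge0$, $\lim_{n\to\infty}\sup_{\mu\in\mathcal D}d_V(\mu P(m;n),\pi)=0$. The limiting distribution $\pi$ satisfies $\sum_{A\in\arg\min_{C\in\mathcal B}h(C)}\pi(A)=1$, and $\lim_{t\to\infty}\sum_{A\in\arg\min_{C\in\mathcal B}h(C)}\mathbb P(B(t)=A)=1$. -/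

import Mathlib

open Filter Topology MeasureTheory

noncomputable section

/-! ### Inhomogeneous Markov chains on a finite state space -/

/-- Total variation distance between two probability vectors on a finite set. -/
def tvDist {S : Type*} [Fintype S] (μ ν : S → ℝ) : ℝ :=
  (1 / 2) * ∑ x, |μ x - ν x|

/-- The transition matrix `P(m; n)` from time `m` to time `n ≥ m` of the chain whose step from
time `s` to time `s + 1` has transition matrix `Q s`, that is `Q m * Q (m + 1) * ⋯ * Q (n - 1)`. -/
def transition {S : Type*} [Fintype S] [DecidableEq S] (Q : ℕ → Matrix S S ℝ) (m n : ℕ) :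
    Matrix S S ℝ :=
  ((List.Ico m n).map Q).prod

/-- `π` is a probability vector such that, for every starting time `m`, the distance
`sup_μ d_V(μ P(m; n), π)` over all initial distributions `μ` tends to `0` as `n → ∞`. -/
def StronglyErgodicTo {S : Type*} [Fintype S] [DecidableEq S] (Q : ℕ → Matrix S S ℝ)
    (π : S → ℝ) : Prop :=
  π ∈ stdSimplex ℝ S ∧
    ∀ m : ℕ, Tendsto
      (fun n : ℕ => ⨆ μ : stdSimplex ℝ S, tvDist (Matrix.vecMul μ.1 (transition Q m n)) π)
      atTop (𝓝 0)

/-- Strong ergodicity of the inhomogeneous chain with one-step transition matrices `Q`. -/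
def StronglyErgodic {S : Type*} [Fintype S] [DecidableEq S] (Q : ℕ → Matrix S S ℝ) : Prop :=
  ∃ π : S → ℝ, StronglyErgodicTo Q π

/-- `B 0, B 1, …` is a Markov chain (with arbitrary initial law) whose step from time `t` to time
`t + 1` has transition matrix `Q t`. -/
def IsMarkovChain {Ω S : Type*} [MeasurableSpace Ω] [MeasurableSpace S] (P : Measure Ω)
    (B : ℕ → Ω → S) (Q : ℕ → Matrix S S ℝ) : Prop :=
  (∀ t, Measurable (B t)) ∧
    ∀ (t : ℕ) (x : ℕ → S),
      P.real {ω | ∀ s ≤ t + 1, B s ω = x s} =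
        P.real {ω | ∀ s ≤ t, B s ω = x s} * Q t (x t) (x (t + 1))

/-! ### The sensor selection problem -/

/-- Activation states of `N` sensors; `true` (that is, `1`) means active. -/
abbrev Config (N : ℕ) : Type := Fin N → Bool

/-- The number `‖B‖₁` of active sensors. -/
def numActive {N : ℕ} (B : Config N) : ℕ :=
  (Finset.univ.filter fun k => B k = true).card

/-- An estimation rule: for each configuration `B`, a map from the data of the active sensors to
an estimate of the data of all sensors. -/
abbrev Estimator {N : ℕ} (E : Fin N → Type*) : Type _ :=
  (B : Config N) → ((i : {i : Fin N // B i = true}) → E i.1) → (k : Fin N) → E k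

/-- The estimate of the data of sensor `k` under configuration `B`. -/
def estimate {N : ℕ} {Ω : Type*} {E : Fin N → Type*} (X : (k : Fin N) → Ω → E k)
    (est : Estimator E) (B : Config N) (k : Fin N) (ω : Ω) : E k :=
  est B (fun i => X i.1 ω) k

/-- The expected error `𝔼 d_B(X, X̂) = ∑ₖ 𝔼 d_B(Xₖ, X̂ₖ)` under configuration `B`. -/
def expectedError {N : ℕ} {Ω : Type*} {E : Fin N → Type*} [MeasurableSpace Ω] (P : Measure Ω)
    (X : (k : Fin N) → Ω → E k) (est : Estimator E)
    (d : Config N → (k : Fin N) → E k → E k → ℝ) (B : Config N) : ℝ :=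
  ∑ k, ∫ ω, d B k (X k ω) (estimate X est B k ω) ∂P

/-- The network cost `h(B) = 𝔼 d_B(X, X̂) + λ ‖B‖₁`. -/
def networkCost {N : ℕ} {Ω : Type*} {E : Fin N → Type*} [MeasurableSpace Ω] (P : Measure Ω)
    (X : (k : Fin N) → Ω → E k) (est : Estimator E)
    (d : Config N → (k : Fin N) → E k → E k → ℝ) (lam : ℝ) (B : Config N) : ℝ :=
  expectedError P X est d B + lam * (numActive B : ℝ)

/-- `Δ = max_{A, B} |h(B) - h(A)|`. -/
def costSpread {N : ℕ} (h : Config N → ℝ) : ℝ :=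
  (Finset.univ : Finset (Config N × Config N)).sup' Finset.univ_nonempty
    fun p => |h p.1 - h p.2|

open Classical in
/-- The set of minimizers of `h`. -/
def argminSet {N : ℕ} (h : Config N → ℝ) : Finset (Config N) :=
  Finset.univ.filter fun A => ∀ C, h A ≤ h C

/-! ### Gibbs sampling -/

/-- The probability that the chosen sensor `j` is activated when the current configuration is `B`
and the inverse temperature is `b`. -/
def activationProb {N : ℕ} (h : Config N → ℝ) (b : ℝ) (B : Config N) (j : Fin N) : ℝ :=
  Real.exp (-b * h (Function.update B j true)) /
    (Real.exp (-b * h (Function.update B j true)) + Real.exp (-b * h (Function.update B j false)))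

/-- One Gibbs update at inverse temperature `b`: choose a sensor `j` uniformly, then set its
state to `1` with probability `activationProb h b B j` and to `0` otherwise. The entry `(B, B')` is
the probability of moving from `B` to `B'`. -/
def gibbsMatrix {N : ℕ} (h : Config N → ℝ) (b : ℝ) : Matrix (Config N) (Config N) ℝ :=
  Matrix.of fun B B' =>
    ∑ j : Fin N, (1 / (N : ℝ)) *
      ((if B' = Function.update B j true then activationProb h b B j else 0) +
        (if B' = Function.update B j false then 1 - activationProb h b B j else 0))

/-- The inverse temperature `β(t) = β₀ log (1 + t)`. -/
def inverseTemp (β₀ : ℝ) (t : ℕ) : ℝ := β₀ * Real.log (1 + (t : ℝ))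

/-- The one-step transition matrices of Gibbs sampling with increasing inverse temperature:
`B (t + 1)` is obtained from `B t` by a Gibbs update at inverse temperature `β(t + 1)`. -/
def modifiedGibbs {N : ℕ} (h : Config N → ℝ) (β₀ : ℝ) (t : ℕ) :
    Matrix (Config N) (Config N) ℝ :=
  gibbsMatrix h (inverseTemp β₀ (t + 1))

end

/-! ### The `ℓ¹` norm and row-stochastic matrices -/

/-! Let `ρ n` be the Gibbs law proportional to `exp (-β(n+1) h)`. By detailed balance it is
stationary for the n-th update. The chain is compared in `ℓ¹` with this moving target rather than
with its limit.

Two rates compete. Updating all sensors in turn reaches any fixed configuration in `N` steps with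
probability at least `ε n = κ (n + N + 1) ^ (-α)`, where `α = β₀ N Δ`
(`le_transition_modifiedGibbs`), so a window of `N` steps contracts differences of laws by `1 - ε
n`. Meanwhile the target drifts by `O(1/n)` per step (`sum_abs_gibbsLaw_sub_le`). Since `α < 1`, the
`ε n` dominate a divergent harmonic series and the drift is `o(ε n)`, so the distance to `ρ n`
vanishes uniformly in the initial law (`eventually_le_of_window_contraction`,
`stronglyErgodicTo_of_minorization`). As `β → ∞`, `ρ n` tends to the uniform law on the minimizers.
-/

theorem sum_vecMul_of_mem_rowStochastic {S : Type*} [Fintype S] [DecidableEq S]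
    {M : Matrix S S ℝ} (hM : M ∈ Matrix.rowStochastic ℝ S) (v : S → ℝ) :
    ∑ y, Matrix.vecMul v M y = ∑ x, v x := by
  simp only [Matrix.vecMul, dotProduct]
  rw [Finset.sum_comm]
  simp [← Finset.mul_sum, Matrix.sum_row_of_mem_rowStochastic hM]

theorem vecMul_mem_stdSimplex {S : Type*} [Fintype S] [DecidableEq S]
    {M : Matrix S S ℝ} (hM : M ∈ Matrix.rowStochastic ℝ S) {v : S → ℝ}
    (hv : v ∈ stdSimplex ℝ S) : Matrix.vecMul v M ∈ stdSimplex ℝ S :=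
  ⟨Matrix.nonneg_vecMul_of_mem_rowStochastic hM hv.1,
    (sum_vecMul_of_mem_rowStochastic hM v).trans hv.2⟩

theorem sum_abs_vecMul_le {S : Type*} [Fintype S] {M : Matrix S S ℝ} {c : ℝ}
    (hM : ∀ x y, 0 ≤ M x y) (hc : ∀ x, ∑ y, M x y = c) (v : S → ℝ) :
    ∑ y, |Matrix.vecMul v M y| ≤ c * ∑ x, |v x| := by
  calc ∑ y, |Matrix.vecMul v M y| ≤ ∑ y, ∑ x, |v x| * M x y := by
        refine Finset.sum_le_sum fun y _ => ?_
        refine (Finset.abs_sum_le_sum_abs _ _).trans_eq ?_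
        exact Finset.sum_congr rfl fun x _ => by rw [abs_mul, abs_of_nonneg (hM x y)]
    _ = c * ∑ x, |v x| := by
        rw [Finset.sum_comm, Finset.mul_sum]
        exact Finset.sum_congr rfl fun x _ => by rw [← Finset.mul_sum, hc, mul_comm]

/-- A stochastic matrix with a column bounded below by `ε` contracts signed measures of total
mass zero by the factor `1 - ε`. -/
theorem sum_abs_vecMul_le_of_minorization {S : Type*} [Fintype S] [DecidableEq S]
    {M : Matrix S S ℝ} (hM : M ∈ Matrix.rowStochastic ℝ S) {ε : ℝ} {y₀ : S}
    (hε : ∀ x, ε ≤ M x y₀) {v : S → ℝ} (hv : ∑ x, v x = 0) :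
    ∑ y, |Matrix.vecMul v M y| ≤ (1 - ε) * ∑ x, |v x| := by
  -- Removing `ε` from column `y₀` does not change the action on `v`, which has mass zero, and
  -- leaves a nonnegative matrix with row sums `1 - ε`.
  let M' : Matrix S S ℝ := fun x y => M x y - if y = y₀ then ε else 0
  have h1 : Matrix.vecMul v M = Matrix.vecMul v M' := by
    ext y
    simp only [Matrix.vecMul, dotProduct, M', mul_sub, Finset.sum_sub_distrib, ← Finset.sum_mul,
      hv, zero_mul, sub_zero]
  rw [h1]
  refine sum_abs_vecMul_le (fun x y => ?_) (fun x => ?_) v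
  · simp only [M']
    split_ifs with h
    · simpa [h] using hε x
    · simpa using Matrix.nonneg_of_mem_rowStochastic hM
  · simp [M', Finset.sum_sub_distrib, Matrix.sum_row_of_mem_rowStochastic hM]

theorem sum_abs_add_le {S : Type*} [Fintype S] (v w : S → ℝ) :
    ∑ x, |v x + w x| ≤ ∑ x, |v x| + ∑ x, |w x| := by
  rw [← Finset.sum_add_distrib]
  exact Finset.sum_le_sum fun x _ => abs_add_le _ _

theorem sum_abs_sub_le_two {S : Type*} [Fintype S] {v w : S → ℝ}
    (hv : v ∈ stdSimplex ℝ S) (hw : w ∈ stdSimplex ℝ S) : ∑ x, |v x - w x| ≤ 2 := by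
  calc ∑ x, |v x - w x| ≤ ∑ x, (v x + w x) := by
        refine Finset.sum_le_sum fun x _ => ?_
        rw [abs_le]
        constructor <;> linarith [hv.1 x, hw.1 x]
    _ = 2 := by rw [Finset.sum_add_distrib, hv.2, hw.2]; norm_num

/-! ### Transition matrices of inhomogeneous chains -/

theorem transition_self {S : Type*} [Fintype S] [DecidableEq S] (Q : ℕ → Matrix S S ℝ) (n : ℕ) :
    transition Q n n = 1 := by
  simp [transition]

theorem transition_succ {S : Type*} [Fintype S] [DecidableEq S] (Q : ℕ → Matrix S S ℝ)
    {m n : ℕ} (hmn : m ≤ n) : transition Q m (n + 1) = transition Q m n * Q n := by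
  simp [transition, List.Ico.succ_top hmn]

theorem transition_mul {S : Type*} [Fintype S] [DecidableEq S] (Q : ℕ → Matrix S S ℝ)
    {l m n : ℕ} (hlm : l ≤ m) (hmn : m ≤ n) :
    transition Q l m * transition Q m n = transition Q l n := by
  simp [transition, ← List.prod_append, ← List.map_append, List.Ico.append_consecutive hlm hmn]

theorem transition_mem_rowStochastic {S : Type*} [Fintype S] [DecidableEq S]
    {Q : ℕ → Matrix S S ℝ} (hQ : ∀ n, Q n ∈ Matrix.rowStochastic ℝ S) (m n : ℕ) :
    transition Q m n ∈ Matrix.rowStochastic ℝ S := by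
  refine Submonoid.list_prod_mem _ fun M hM => ?_
  obtain ⟨k, -, rfl⟩ := List.mem_map.1 hM
  exact hQ k

/-- Running the chain from its instantaneous stationary law `ρ n` for `k` steps costs at most the
total variation of `ρ` along the way. -/
theorem sum_abs_vecMul_transition_sub_le {S : Type*} [Fintype S] [DecidableEq S]
    {Q : ℕ → Matrix S S ℝ} (hQ : ∀ n, Q n ∈ Matrix.rowStochastic ℝ S) {ρ : ℕ → S → ℝ}
    (hρQ : ∀ n, Matrix.vecMul (ρ n) (Q n) = ρ n) {n : ℕ} {c : ℝ}
    (hc : ∀ i, n ≤ i → ∑ x, |ρ i x - ρ (i + 1) x| ≤ c) (k : ℕ) :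
    ∑ x, |Matrix.vecMul (ρ n) (transition Q n (n + k)) x - ρ (n + k) x| ≤ k * c := by
  induction k with
  | zero => simp [transition_self]
  | succ k ih =>
    set w := Matrix.vecMul (ρ n) (transition Q n (n + k)) with hw
    have h1 : Matrix.vecMul (ρ n) (transition Q n (n + (k + 1))) = Matrix.vecMul w (Q (n + k)) := by
      rw [← add_assoc, transition_succ Q (Nat.le_add_right n k), hw, Matrix.vecMul_vecMul]
    have h2 : ∀ x, Matrix.vecMul w (Q (n + k)) x - ρ (n + k + 1) x =
        Matrix.vecMul (w - ρ (n + k)) (Q (n + k)) x + (ρ (n + k) x - ρ (n + k + 1) x) := by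
      intro x
      rw [Matrix.sub_vecMul, Pi.sub_apply, hρQ]
      ring
    rw [h1, ← add_assoc]
    simp only [h2]
    refine (sum_abs_add_le _ _).trans ?_
    have h3 := sum_abs_vecMul_le (Matrix.mem_rowStochastic_iff_sum.1 (hQ (n + k))).1
      (Matrix.mem_rowStochastic_iff_sum.1 (hQ (n + k))).2 (w - ρ (n + k))
    have h4 := hc (n + k) (Nat.le_add_right n k)
    simp only [Pi.sub_apply] at h3
    push_cast
    linarith

/-! ### A contraction recursion along windows of fixed length -/

/-- Once `δ ≤ (η/2) ε`, the excess of `a` over `η/2` shrinks by `1 - ε ≤ exp (-ε)` per window, and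
the harmonic series diverges along each residue class mod `N`. The threshold `n₁` precedes `a`,
which later gives uniformity over initial laws. -/
theorem eventually_le_of_window_contraction {N : ℕ} (hN : 0 < N) {κ K : ℝ} (hκ : 0 < κ)
    (hK : 0 < K) {ε δ : ℕ → ℝ} (hε : ∀ n : ℕ, κ / (n + K) ≤ ε n) (hε1 : ∀ n, ε n ≤ 1)
    (hδ : ∀ η > 0, ∀ᶠ n in atTop, δ n ≤ η * ε n) (m : ℕ) {η : ℝ} (hη : 0 < η) :
    ∃ n₁, ∀ a : ℕ → ℝ, (∀ n, m ≤ n → a n ≤ 2) →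
      (∀ n, m ≤ n → a (n + N) ≤ (1 - ε n) * a n + δ n) → ∀ n, n₁ ≤ n → a n ≤ η := by
  obtain ⟨n', hn'⟩ := eventually_atTop.1 (hδ (η / 2) (half_pos hη))
  set n₀ := max m n' with hn₀
  -- Chosen so that `n₀ + r + k * N + K ≤ L * (k + 1)` for every `r < N`.
  set L : ℝ := n₀ + N + K with hL
  have hLpos : 0 < L := by positivity
  have hlim : Tendsto (fun k : ℕ => 2 * Real.exp (-(κ / L * ∑ i ∈ Finset.range k,
      1 / ((i : ℝ) + 1)))) atTop (𝓝 0) := by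
    have h := (Real.tendsto_exp_neg_atTop_nhds_zero.comp
      (Real.tendsto_sum_range_one_div_nat_succ_atTop.const_mul_atTop
        (div_pos hκ hLpos))).const_mul 2
    simpa using h
  obtain ⟨k₁, hk₁⟩ := eventually_atTop.1 (hlim.eventually (ge_mem_nhds (half_pos hη)))
  refine ⟨n₀ + k₁ * N, fun a ha hrec n hn => ?_⟩
  have key : ∀ r < N, ∀ k, a (n₀ + r + k * N) ≤
      η / 2 + 2 * Real.exp (-(κ / L * ∑ i ∈ Finset.range k, 1 / ((i : ℝ) + 1))) := by
    intro r hr k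
    induction k with
    | zero =>
      have := ha (n₀ + r + 0 * N) (by omega)
      simp only [Finset.range_zero, Finset.sum_empty, mul_zero, neg_zero, Real.exp_zero]
      linarith
    | succ k ih =>
      set p := n₀ + r + k * N with hp
      have e1 : n₀ + r + (k + 1) * N = p + N := by rw [hp]; ring
      have e2 := hrec p (by omega)
      have e3 := hn' p (by omega)
      have e4 : κ / L * (1 / ((k : ℝ) + 1)) ≤ ε p := by
        refine le_trans ?_ (hε p)
        rw [div_mul_div_comm, mul_one]
        refine div_le_div_of_nonneg_left hκ.le (by positivity) ?_
        have hr' : (r : ℝ) ≤ N := by exact_mod_cast hr.le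
        have : (0 : ℝ) ≤ k * n₀ + k * K := by positivity
        rw [hp, hL]
        push_cast
        nlinarith
      have e5 : 1 - ε p ≤ Real.exp (-(κ / L * (1 / ((k : ℝ) + 1)))) := by
        linarith [Real.add_one_le_exp (-(κ / L * (1 / ((k : ℝ) + 1))))]
      rw [e1, Finset.sum_range_succ, mul_add, neg_add, Real.exp_add]
      set X := Real.exp (-(κ / L * ∑ i ∈ Finset.range k, 1 / ((i : ℝ) + 1)))
      have hX : 0 < X := Real.exp_pos _
      have e6 := mul_le_mul_of_nonneg_left ih (sub_nonneg.2 (hε1 p))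
      have e7 := mul_le_mul_of_nonneg_right e5 hX.le
      nlinarith
  have hdiv : n = n₀ + (n - n₀) % N + (n - n₀) / N * N := by
    have := Nat.mod_add_div' (n - n₀) N
    have : n₀ ≤ n := le_trans (Nat.le_add_right _ _) hn
    omega
  have hk : k₁ ≤ (n - n₀) / N := (Nat.le_div_iff_mul_le hN).2 (by omega)
  rw [hdiv]
  have := key _ (Nat.mod_lt (n - n₀) hN) ((n - n₀) / N)
  linarith [hk₁ _ hk]

/-- Here `α < 1` makes a drift of order `1/n` negligible against the contraction rate. -/
theorem eventually_div_le_mul_rpow {C κ K α : ℝ} (hκ : 0 < κ) (hK : 1 ≤ K)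
    (hα : α < 1) {η : ℝ} (hη : 0 < η) :
    ∀ᶠ n : ℕ in atTop, C / ((n : ℝ) + 1) ≤ η * (κ * ((n : ℝ) + K) ^ (-α)) := by
  have h1 : Tendsto (fun n : ℕ => ((n : ℝ) + K) ^ (1 - α)) atTop atTop :=
    (tendsto_rpow_atTop (by linarith)).comp
      (tendsto_atTop_add_const_right _ _ tendsto_natCast_atTop_atTop)
  filter_upwards [h1.eventually_ge_atTop (C * K / (η * κ))] with n hn
  have hu : (0 : ℝ) < n + K := by positivity
  have h2 : ((n : ℝ) + K) ^ (1 - α) = (n + K) * ((n : ℝ) + K) ^ (-α) := by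
    rw [sub_eq_add_neg, Real.rpow_add hu, Real.rpow_one]
  rw [h2, div_le_iff₀ (by positivity)] at hn
  rw [div_le_iff₀ (by positivity)]
  set U := ((n : ℝ) + K) ^ (-α)
  have hU : 0 < U := Real.rpow_pos_of_pos hu _
  have h3 : (n : ℝ) + K ≤ K * (n + 1) := by nlinarith [(Nat.cast_nonneg n : (0 : ℝ) ≤ n)]
  have h4 : C * K ≤ K * (η * (κ * U) * (n + 1)) := by
    have := mul_le_mul_of_nonneg_left h3 (by positivity : 0 ≤ η * κ * U)
    nlinarith
  have hK0 : 0 < K := by linarith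
  rw [mul_comm C K] at h4
  exact le_of_mul_le_mul_left h4 hK0

/-! ### Strong ergodicity from a slowly vanishing minorization -/

theorem tvDist_le_one {S : Type*} [Fintype S] {v w : S → ℝ}
    (hv : v ∈ stdSimplex ℝ S) (hw : w ∈ stdSimplex ℝ S) : tvDist v w ≤ 1 := by
  have := sum_abs_sub_le_two hv hw
  unfold tvDist
  linarith

theorem tvDist_nonneg {S : Type*} [Fintype S] (v w : S → ℝ) : 0 ≤ tvDist v w := by
  unfold tvDist
  positivity

theorem tendsto_of_tendsto_tvDist {S ι : Type*} [Fintype S] {l : Filter ι} {v : ι → S → ℝ}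
    {w : S → ℝ} (h : Tendsto (fun i => tvDist (v i) w) l (𝓝 0)) (x : S) :
    Tendsto (fun i => v i x) l (𝓝 (w x)) := by
  rw [tendsto_iff_dist_tendsto_zero]
  refine squeeze_zero (fun _ => dist_nonneg) (fun i => ?_) (by simpa using h.const_mul 2)
  rw [Real.dist_eq]
  have := Finset.single_le_sum (f := fun x => |v i x - w x|) (fun _ _ => abs_nonneg _)
    (Finset.mem_univ x)
  unfold tvDist
  linarith

theorem StronglyErgodicTo.tendsto_vecMul {S : Type*} [Fintype S] [DecidableEq S]
    {Q : ℕ → Matrix S S ℝ} (hQ : ∀ n, Q n ∈ Matrix.rowStochastic ℝ S) {π : S → ℝ}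
    (hπ : StronglyErgodicTo Q π) {μ : S → ℝ} (hμ : μ ∈ stdSimplex ℝ S) (m : ℕ) (x : S) :
    Tendsto (fun n => Matrix.vecMul μ (transition Q m n) x) atTop (𝓝 (π x)) := by
  refine tendsto_of_tendsto_tvDist (v := fun n => Matrix.vecMul μ (transition Q m n)) ?_ x
  refine squeeze_zero (fun _ => tvDist_nonneg _ _) (fun n => ?_) (hπ.2 m)
  refine le_ciSup (f := fun μ : stdSimplex ℝ S =>
    tvDist (Matrix.vecMul μ.1 (transition Q m n)) π) ⟨1, ?_⟩ ⟨μ, hμ⟩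
  rintro _ ⟨ν, rfl⟩
  exact tvDist_le_one (vecMul_mem_stdSimplex (transition_mem_rowStochastic hQ m n) ν.2) hπ.1

theorem stronglyErgodicTo_of_minorization {S : Type*} [Fintype S] [DecidableEq S] [Nonempty S]
    {Q : ℕ → Matrix S S ℝ} (hQ : ∀ n, Q n ∈ Matrix.rowStochastic ℝ S) {ρ : ℕ → S → ℝ}
    (hρ : ∀ n, ρ n ∈ stdSimplex ℝ S) (hρQ : ∀ n, Matrix.vecMul (ρ n) (Q n) = ρ n) {D : ℝ}
    (hD : ∀ n : ℕ, ∑ x, |ρ n x - ρ (n + 1) x| ≤ D / (n + 1)) {π : S → ℝ}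
    (hρπ : ∀ x, Tendsto (fun n => ρ n x) atTop (𝓝 (π x))) {N : ℕ} (hN : 0 < N) {κ K α : ℝ}
    (hκ : 0 < κ) (hK : 1 ≤ K) (hα : α < 1) {y₀ : S}
    (hmin : ∀ (n : ℕ) x, κ * ((n : ℝ) + K) ^ (-α) ≤ transition Q n (n + N) x y₀) :
    StronglyErgodicTo Q π := by
  have hπ : π ∈ stdSimplex ℝ S := by
    refine ⟨fun x => ge_of_tendsto' (hρπ x) fun n => (hρ n).1 x, ?_⟩
    refine tendsto_nhds_unique (tendsto_finsetSum Finset.univ fun x _ => hρπ x) ?_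
    simpa only [(hρ _).2] using tendsto_const_nhds
  have hD0 : 0 ≤ D := by
    have h := (Finset.sum_nonneg fun x _ => abs_nonneg _).trans (hD 0)
    simpa using h
  refine ⟨hπ, fun m => ?_⟩
  have hρlim : Tendsto (fun n => ∑ x, |ρ n x - π x|) atTop (𝓝 0) := by
    have h := tendsto_finsetSum Finset.univ fun x (_ : x ∈ Finset.univ) =>
      ((hρπ x).sub_const (π x)).abs
    simpa using h
  refine tendsto_order.2 ⟨fun c hc => Eventually.of_forall fun n =>
    hc.trans_le (Real.iSup_nonneg fun μ => tvDist_nonneg _ _), fun c hc => ?_⟩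
  obtain ⟨n₁, hn₁⟩ := eventually_le_of_window_contraction (N := N) hN hκ
    (by linarith : (0 : ℝ) < K) (ε := fun n => κ * ((n : ℝ) + K) ^ (-α))
    (δ := fun n => N * D / ((n : ℝ) + 1))
    (fun n => by
      have h1 : (1 : ℝ) ≤ n + K := by linarith [(Nat.cast_nonneg n : (0 : ℝ) ≤ n)]
      rw [div_eq_mul_inv, ← Real.rpow_neg_one]
      exact mul_le_mul_of_nonneg_left
        (Real.rpow_le_rpow_of_exponent_le h1 (by linarith)) hκ.le)
    (fun n => (hmin n y₀).trans
      (Matrix.le_one_of_mem_rowStochastic (transition_mem_rowStochastic hQ _ _)))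
    (fun η hη => eventually_div_le_mul_rpow hκ hK hα hη) m
    (half_pos hc)
  filter_upwards [eventually_ge_atTop n₁, eventually_ge_atTop m,
    hρlim.eventually (gt_mem_nhds (half_pos hc))] with n hn hmn hρn
  refine (ciSup_le fun μ => ?_).trans_lt (show c / 2 < c by linarith)
  have hmem : ∀ n, Matrix.vecMul μ.1 (transition Q m n) ∈ stdSimplex ℝ S := fun n =>
    vecMul_mem_stdSimplex (transition_mem_rowStochastic hQ m n) μ.2
  have h1 := hn₁ (fun n => ∑ x, |Matrix.vecMul μ.1 (transition Q m n) x - ρ n x|)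
    (fun n _ => sum_abs_sub_le_two (hmem n) (hρ n)) (fun p hp => by
      -- The first term has mass zero and is contracted by the window; the second is the drift of
      -- the target over `N` steps.
      have e1 : ∀ x, Matrix.vecMul μ.1 (transition Q m (p + N)) x - ρ (p + N) x =
          Matrix.vecMul (Matrix.vecMul μ.1 (transition Q m p) - ρ p) (transition Q p (p + N)) x +
          (Matrix.vecMul (ρ p) (transition Q p (p + N)) x - ρ (p + N) x) := by
        intro x
        rw [Matrix.sub_vecMul, Pi.sub_apply, Matrix.vecMul_vecMul,
          transition_mul Q hp (Nat.le_add_right p N)]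
        ring
      simp only [e1]
      refine (sum_abs_add_le _ _).trans (add_le_add ?_ ?_)
      · refine sum_abs_vecMul_le_of_minorization (transition_mem_rowStochastic hQ _ _) (hmin p) ?_
        simp only [Pi.sub_apply, Finset.sum_sub_distrib]
        rw [(hmem p).2, (hρ p).2, sub_self]
      · rw [mul_div_assoc]
        refine sum_abs_vecMul_transition_sub_le hQ hρQ (fun i hi => (hD i).trans ?_) N
        exact div_le_div_of_nonneg_left hD0 (by positivity) (by gcongr)) n hn
  have h2 := sum_abs_add_le (fun x => Matrix.vecMul μ.1 (transition Q m n) x - ρ n x)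
    (fun x => ρ n x - π x)
  simp only [sub_add_sub_cancel] at h2
  unfold tvDist
  linarith

/-! ### Laws of Markov chains -/

/-- The Markov property is given for whole paths from time `0`; the values at times before `k` are
summed out one at a time. The case `k = t` yields the one-step law. -/
theorem IsMarkovChain.measureReal_path_from {Ω S : Type*} [MeasurableSpace Ω] [Fintype S]
    [DecidableEq S] [MeasurableSpace S] [MeasurableSingletonClass S] {P : Measure Ω}
    [IsProbabilityMeasure P] {B : ℕ → Ω → S} {Q : ℕ → Matrix S S ℝ} (hB : IsMarkovChain P B Q)
    (t k : ℕ) (hk : k ≤ t) (x : ℕ → S) :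
    P.real {ω | ∀ s, k ≤ s → s ≤ t + 1 → B s ω = x s} =
      P.real {ω | ∀ s, k ≤ s → s ≤ t → B s ω = x s} * Q t (x t) (x (t + 1)) := by
  induction k generalizing x with
  | zero => simpa using hB.2 t x
  | succ k ih =>
    have split : ∀ r, k + 1 ≤ r → P.real {ω | ∀ s, k + 1 ≤ s → s ≤ r → B s ω = x s} =
        ∑ y, P.real {ω | ∀ s, k ≤ s → s ≤ r → B s ω = Function.update x k y s} := by
      intro r hr
      rw [← measureReal_biUnion_finset]
      · congr 1
        ext ω
        simp only [Set.mem_ofPred_eq, Finset.mem_univ, Set.iUnion_true, Set.mem_iUnion]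
        constructor
        · intro h
          refine ⟨B k ω, fun s hs hsr => ?_⟩
          rcases hs.eq_or_lt with rfl | hs
          · simp
          · rw [Function.update_of_ne hs.ne', h s hs hsr]
        · rintro ⟨y, h⟩ s hs hsr
          rw [h s (by omega) hsr, Function.update_of_ne (by omega)]
      · intro y _ z _ hyz
        refine Set.disjoint_left.2 fun ω hy hz => hyz ?_
        have h1 := hy k le_rfl (by omega)
        have h2 := hz k le_rfl (by omega)
        simpa using h1.symm.trans h2
      · intro y _
        simp only [Set.ofPred_forall]
        refine MeasurableSet.iInter fun s => MeasurableSet.iInter fun _ =>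
          MeasurableSet.iInter fun _ => ?_
        exact hB.1 s (measurableSet_singleton _)
    rw [split _ (by omega), split _ hk, Finset.sum_mul]
    refine Finset.sum_congr rfl fun y _ => ?_
    rw [ih (by omega), Function.update_of_ne (by omega), Function.update_of_ne (by omega)]

theorem IsMarkovChain.law_succ {Ω S : Type*} [MeasurableSpace Ω] [Fintype S]
    [DecidableEq S] [MeasurableSpace S] [MeasurableSingletonClass S] {P : Measure Ω}
    [IsProbabilityMeasure P] {B : ℕ → Ω → S} {Q : ℕ → Matrix S S ℝ} (hB : IsMarkovChain P B Q)
    (t : ℕ) : (fun y => P.real {ω | B (t + 1) ω = y}) =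
      Matrix.vecMul (fun y => P.real {ω | B t ω = y}) (Q t) := by
  ext y
  simp only [Matrix.vecMul, dotProduct]
  have hset : {ω | B (t + 1) ω = y} =
      ⋃ x ∈ (Finset.univ : Finset S), {ω | B t ω = x ∧ B (t + 1) ω = y} := by
    ext ω
    simp
  rw [hset, measureReal_biUnion_finset]
  · refine Finset.sum_congr rfl fun x _ => ?_
    have h := hB.measureReal_path_from t t le_rfl (fun s => if s = t then x else y)
    simp only [if_true, Nat.succ_ne_self, if_false] at h
    convert h using 2
    · ext ω
      simp only [Set.mem_ofPred_eq]
      constructor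
      · rintro ⟨h1, h2⟩ s hs hs'
        obtain rfl | rfl : s = t ∨ s = t + 1 := by omega
        · simpa using h1
        · simpa using h2
      · intro h
        exact ⟨by simpa using h t le_rfl (by omega), by simpa using h (t + 1) (by omega) le_rfl⟩
    · congr 1
      ext ω
      simp only [Set.mem_ofPred_eq]
      constructor
      · intro h1 s hs hs'
        obtain rfl : s = t := by omega
        simpa using h1
      · intro h
        simpa using h t le_rfl le_rfl
  · intro x _ z _ hxz
    exact Set.disjoint_left.2 fun ω hx hz => hxz (hx.1.symm.trans hz.1)
  · intro x _
    exact (hB.1 t (measurableSet_singleton x)).inter (hB.1 (t + 1) (measurableSet_singleton y))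

theorem IsMarkovChain.law_eq_vecMul_transition {Ω S : Type*} [MeasurableSpace Ω] [Fintype S]
    [DecidableEq S] [MeasurableSpace S] [MeasurableSingletonClass S] {P : Measure Ω}
    [IsProbabilityMeasure P] {B : ℕ → Ω → S} {Q : ℕ → Matrix S S ℝ} (hB : IsMarkovChain P B Q)
    (t : ℕ) : (fun y => P.real {ω | B t ω = y}) =
      Matrix.vecMul (fun y => P.real {ω | B 0 ω = y}) (transition Q 0 t) := by
  induction t with
  | zero => simp [transition_self]
  | succ t ih => rw [hB.law_succ, ih, Matrix.vecMul_vecMul, ← transition_succ Q (Nat.zero_le t)]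

theorem measureReal_eq_mem_stdSimplex {Ω S : Type*} [MeasurableSpace Ω] [Fintype S]
    [MeasurableSpace S] [MeasurableSingletonClass S] {P : Measure Ω}
    [IsProbabilityMeasure P] {f : Ω → S} (hf : Measurable f) :
    (fun y => P.real {ω | f ω = y}) ∈ stdSimplex ℝ S := by
  refine ⟨fun _ => measureReal_nonneg, ?_⟩
  have h := sum_measureReal_preimage_singleton (μ := P) (Finset.univ : Finset S) (f := f)
    fun y _ => hf (measurableSet_singleton y)
  exact h.trans (by simp)

/-! ### Gibbs distributions on configurations -/

/-- The Gibbs distribution of the cost `h` at inverse temperature `b`. -/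
noncomputable def gibbsLaw {N : ℕ} (h : Config N → ℝ) (b : ℝ) (B : Config N) : ℝ :=
  Real.exp (-b * h B) / ∑ C, Real.exp (-b * h C)

/-- The uniform distribution on the minimizers of `h`. -/
noncomputable def argminLaw {N : ℕ} (h : Config N → ℝ) (B : Config N) : ℝ :=
  Set.indicator (argminSet h) (fun _ => ((argminSet h).card : ℝ)⁻¹) B

theorem sum_exp_pos {N : ℕ} (h : Config N → ℝ) (b : ℝ) : 0 < ∑ C, Real.exp (-b * h C) :=
  Finset.sum_pos (fun _ _ => Real.exp_pos _) Finset.univ_nonempty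

theorem gibbsLaw_mem_stdSimplex {N : ℕ} (h : Config N → ℝ) (b : ℝ) :
    gibbsLaw h b ∈ stdSimplex ℝ (Config N) := by
  refine ⟨fun B => div_nonneg (Real.exp_pos _).le (sum_exp_pos h b).le, ?_⟩
  simp only [gibbsLaw]
  rw [← Finset.sum_div, div_self (sum_exp_pos h b).ne']

/-- Allows normalizing the minimum of the cost to `0`. -/
theorem gibbsLaw_sub_const {N : ℕ} (h : Config N → ℝ) (b c : ℝ) :
    gibbsLaw (fun B => h B - c) b = gibbsLaw h b := by
  ext B
  have e : ∀ C, Real.exp (-b * (h C - c)) = Real.exp (b * c) * Real.exp (-b * h C) := by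
    intro C
    rw [← Real.exp_add]
    congr 1
    ring
  simp only [gibbsLaw, e]
  rw [← Finset.mul_sum, mul_div_mul_left _ _ (Real.exp_pos _).ne']

theorem abs_sub_le_costSpread {N : ℕ} (h : Config N → ℝ) (A B : Config N) :
    |h A - h B| ≤ costSpread h :=
  Finset.le_sup' (fun p : Config N × Config N => |h p.1 - h p.2|) (Finset.mem_univ (A, B))

theorem costSpread_nonneg {N : ℕ} (h : Config N → ℝ) : 0 ≤ costSpread h :=
  (abs_nonneg _).trans (abs_sub_le_costSpread h (fun _ => true) fun _ => true)

theorem mem_argminSet {N : ℕ} {h : Config N → ℝ} {A : Config N} :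
    A ∈ argminSet h ↔ ∀ C, h A ≤ h C := by
  simp [argminSet]

theorem argminSet_nonempty {N : ℕ} (h : Config N → ℝ) : (argminSet h).Nonempty :=
  let ⟨A, hA⟩ := Finite.exists_min h
  ⟨A, mem_argminSet.2 hA⟩

theorem sum_argminSet_argminLaw {N : ℕ} (h : Config N → ℝ) :
    ∑ A ∈ argminSet h, argminLaw h A = 1 := by
  have h0 : ((argminSet h).card : ℝ) ≠ 0 :=
    Nat.cast_ne_zero.2 (Finset.card_ne_zero.2 (argminSet_nonempty h))
  have e : ∀ A ∈ argminSet h, argminLaw h A = ((argminSet h).card : ℝ)⁻¹ := fun A hA =>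
    Set.indicator_of_mem (Finset.mem_coe.2 hA) _
  rw [Finset.sum_congr rfl e]
  simp [h0]

theorem tendsto_gibbsLaw {N : ℕ} (h : Config N → ℝ) (B : Config N) :
    Tendsto (fun b => gibbsLaw h b B) atTop (𝓝 (argminLaw h B)) := by
  classical
  obtain ⟨A, hA⟩ := Finite.exists_min h
  have hw : ∀ C, Tendsto (fun b => Real.exp (-b * (h C - h A))) atTop
      (𝓝 (if C ∈ argminSet h then 1 else 0)) := by
    intro C
    by_cases hC : C ∈ argminSet h
    · have : h C = h A := le_antisymm (mem_argminSet.1 hC A) (hA C)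
      simp [hC, this]
    · rw [if_neg hC]
      have hlt : 0 < h C - h A := by
        by_contra hle
        exact hC (mem_argminSet.2 fun D => by linarith [hA D])
      refine Real.tendsto_exp_atBot.comp ?_
      exact tendsto_neg_atTop_atBot.atBot_mul_const hlt
  have hZ := tendsto_finsetSum Finset.univ fun C (_ : C ∈ Finset.univ) => hw C
  have h0 : ((argminSet h).card : ℝ) ≠ 0 :=
    Nat.cast_ne_zero.2 (Finset.card_ne_zero.2 (argminSet_nonempty h))
  have hlim := (hw B).div hZ (by simpa using h0)
  have e : ∀ b, gibbsLaw h b B = gibbsLaw (fun C => h C - h A) b B := fun b => by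
    rw [gibbsLaw_sub_const]
  simp only [e]
  have elim : argminLaw h B = (if B ∈ argminSet h then 1 else 0) /
      ∑ C, if C ∈ argminSet h then (1 : ℝ) else 0 := by
    by_cases hB : B ∈ argminSet h <;> simp [argminLaw, hB]
  rw [elim]
  exact hlim

/-- With the cost normalized into `[0, Δ]`, raising `b` to `b'` costs each weight at most a factor
`exp (-s)` and does not increase the partition function. Equal total masses turn this one-sided
bound into an `ℓ¹` bound. -/
theorem sum_abs_gibbsLaw_sub_le {N : ℕ} (h : Config N → ℝ) {b b' : ℝ} (hbb' : b ≤ b') :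
    ∑ B, |gibbsLaw h b B - gibbsLaw h b' B| ≤ 2 * ((b' - b) * costSpread h) := by
  obtain ⟨A, hA⟩ := Finite.exists_min h
  set g : Config N → ℝ := fun C => h C - h A with hg
  have hg0 : ∀ C, 0 ≤ g C := fun C => sub_nonneg.2 (hA C)
  have hgΔ : ∀ C, g C ≤ costSpread h := fun C =>
    (le_abs_self _).trans (abs_sub_le_costSpread h C A)
  set s := (b' - b) * costSpread h with hs
  have hs0 : 0 ≤ s := mul_nonneg (sub_nonneg.2 hbb') (costSpread_nonneg h)
  have hρ : ∀ b, gibbsLaw h b = gibbsLaw g b := fun b => (gibbsLaw_sub_const h b (h A)).symm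
  have key : ∀ B, (1 - s) * gibbsLaw h b B ≤ gibbsLaw h b' B := by
    intro B
    have hpos : 0 ≤ gibbsLaw h b B := (gibbsLaw_mem_stdSimplex h b).1 B
    calc (1 - s) * gibbsLaw h b B ≤ Real.exp (-s) * gibbsLaw h b B :=
          mul_le_mul_of_nonneg_right (by linarith [Real.add_one_le_exp (-s)]) hpos
      _ ≤ gibbsLaw h b' B := by
          rw [hρ, hρ]
          unfold gibbsLaw
          rw [← mul_div_assoc, ← Real.exp_add]
          refine div_le_div₀ (Real.exp_pos _).le (Real.exp_le_exp.2 ?_) (sum_exp_pos g b') ?_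
          · have := mul_le_mul_of_nonneg_left (hgΔ B) (sub_nonneg.2 hbb')
            rw [hs]
            linarith
          · refine Finset.sum_le_sum fun C _ => Real.exp_le_exp.2 ?_
            have := mul_le_mul_of_nonneg_right hbb' (hg0 C)
            linarith
  have hb := gibbsLaw_mem_stdSimplex h b
  have hb' := gibbsLaw_mem_stdSimplex h b'
  calc ∑ B, |gibbsLaw h b B - gibbsLaw h b' B|
      ≤ ∑ B, (gibbsLaw h b' B - gibbsLaw h b B + 2 * s * gibbsLaw h b B) := by
        refine Finset.sum_le_sum fun B _ => ?_
        have h1 := key B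
        have h2 := mul_nonneg hs0 (hb.1 B)
        rw [abs_le]
        constructor <;> linarith
    _ = 2 * s := by
        rw [Finset.sum_add_distrib, Finset.sum_sub_distrib, ← Finset.mul_sum, hb.2, hb'.2]
        ring

/-! ### The Gibbs update matrix -/

/-- This form makes detailed balance visible: the condition and the denominator are symmetric in `B`
and `B'`. -/
theorem gibbsMatrix_apply {N : ℕ} (h : Config N → ℝ) (b : ℝ) (B B' : Config N) :
    gibbsMatrix h b B B' = ∑ j : Fin N, (1 / (N : ℝ)) *
      if ∀ a, Function.update B j a = Function.update B' j a then
        Real.exp (-b * h B') / (Real.exp (-b * h (Function.update B j true)) +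
          Real.exp (-b * h (Function.update B j false))) else 0 := by
  simp only [gibbsMatrix, Matrix.of_apply]
  refine Finset.sum_congr rfl fun j _ => ?_
  congr 1
  have hne : Function.update B j true ≠ Function.update B j false := fun e => by
    simpa using congrFun e j
  by_cases h1 : B' = Function.update B j true
  · rw [if_pos h1, if_neg fun h2 => hne (h1.symm.trans h2),
      if_pos fun a => by rw [h1, Function.update_idem], activationProb, ← h1, add_zero]
  · by_cases h2 : B' = Function.update B j false
    · rw [if_neg h1, if_pos h2, if_pos fun a => by rw [h2, Function.update_idem], activationProb,
        one_sub_div (by positivity), add_sub_cancel_left, zero_add, ← h2]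
    · rw [if_neg h1, if_neg h2, if_neg, add_zero]
      intro h3
      have h4 := h3 (B' j)
      rw [Function.update_eq_self] at h4
      cases hj : B' j <;> rw [hj] at h4
      · exact h2 h4.symm
      · exact h1 h4.symm

theorem gibbsMatrix_mem_rowStochastic {N : ℕ} (hN : 0 < N) (h : Config N → ℝ) (b : ℝ) :
    gibbsMatrix h b ∈ Matrix.rowStochastic ℝ (Config N) := by
  refine Matrix.mem_rowStochastic_iff_sum.2 ⟨fun B B' => ?_, fun B => ?_⟩
  · rw [gibbsMatrix_apply]
    exact Finset.sum_nonneg fun j _ => by positivity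
  · have hN' : (N : ℝ) ≠ 0 := Nat.cast_ne_zero.2 hN.ne'
    simp only [gibbsMatrix, Matrix.of_apply]
    rw [Finset.sum_comm]
    simp [← Finset.mul_sum, Finset.sum_add_distrib, hN']

theorem gibbsLaw_vecMul_gibbsMatrix {N : ℕ} (hN : 0 < N) (h : Config N → ℝ) (b : ℝ) :
    Matrix.vecMul (gibbsLaw h b) (gibbsMatrix h b) = gibbsLaw h b := by
  have balance : ∀ B B', gibbsLaw h b B * gibbsMatrix h b B B' =
      gibbsLaw h b B' * gibbsMatrix h b B' B := by
    intro B B'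
    rw [gibbsMatrix_apply, gibbsMatrix_apply, Finset.mul_sum, Finset.mul_sum]
    refine Finset.sum_congr rfl fun j _ => ?_
    by_cases hj : ∀ a, Function.update B j a = Function.update B' j a
    · rw [if_pos hj, if_pos fun a => (hj a).symm, hj, hj]
      unfold gibbsLaw
      ring
    · rw [if_neg hj, if_neg fun h' => hj fun a => (h' a).symm]
      simp
  ext B'
  simp only [Matrix.vecMul, dotProduct, balance _ B']
  rw [← Finset.mul_sum, Matrix.sum_row_of_mem_rowStochastic
    (gibbsMatrix_mem_rowStochastic hN h b), mul_one]

theorem le_gibbsMatrix_update {N : ℕ} (h : Config N → ℝ) {b : ℝ} (hb : 0 ≤ b) (B : Config N)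
    (j : Fin N) (a : Bool) :
    Real.exp (-(b * costSpread h)) / (2 * N) ≤ gibbsMatrix h b B (Function.update B j a) := by
  rw [gibbsMatrix_apply]
  refine le_trans ?_ (Finset.single_le_sum (fun j _ => by positivity) (Finset.mem_univ j))
  rw [if_pos fun a' => by rw [Function.update_idem]]
  have hexp : ∀ C, Real.exp (-(b * costSpread h)) * Real.exp (-b * h C) ≤
      Real.exp (-b * h (Function.update B j a)) := by
    intro C
    rw [← Real.exp_add, Real.exp_le_exp]
    have := mul_le_mul_of_nonneg_left
      ((le_abs_self _).trans (abs_sub_le_costSpread h (Function.update B j a) C)) hb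
    linarith
  have hmain : Real.exp (-(b * costSpread h)) / 2 ≤ Real.exp (-b * h (Function.update B j a)) /
      (Real.exp (-b * h (Function.update B j true)) +
        Real.exp (-b * h (Function.update B j false))) := by
    rw [div_le_div_iff₀ two_pos (by positivity)]
    linarith [hexp (Function.update B j true), hexp (Function.update B j false)]
  calc Real.exp (-(b * costSpread h)) / (2 * N)
      = 1 / (N : ℝ) * (Real.exp (-(b * costSpread h)) / 2) := by
        rw [div_mul_div_comm, one_mul, mul_comm (2 : ℝ)]
    _ ≤ _ := mul_le_mul_of_nonneg_left hmain (by positivity)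

/-! ### Gibbs sampling with logarithmically increasing inverse temperature -/

theorem inverseTemp_mono {β₀ : ℝ} (hβ₀ : 0 ≤ β₀) : Monotone (inverseTemp β₀) := by
  intro s t hst
  have : (s : ℝ) ≤ t := Nat.cast_le.2 hst
  exact mul_le_mul_of_nonneg_left (Real.log_le_log (by positivity) (by linarith)) hβ₀

theorem inverseTemp_nonneg {β₀ : ℝ} (hβ₀ : 0 ≤ β₀) (t : ℕ) : 0 ≤ inverseTemp β₀ t := by
  have := inverseTemp_mono hβ₀ (Nat.zero_le t)
  simpa [inverseTemp] using this

theorem tendsto_inverseTemp {β₀ : ℝ} (hβ₀ : 0 < β₀) :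
    Tendsto (inverseTemp β₀) atTop atTop :=
  (Real.tendsto_log_atTop.comp
    (tendsto_atTop_add_const_left _ _ tendsto_natCast_atTop_atTop)).const_mul_atTop hβ₀

theorem inverseTemp_succ_sub_le {β₀ : ℝ} (hβ₀ : 0 ≤ β₀) (t : ℕ) :
    inverseTemp β₀ (t + 1) - inverseTemp β₀ t ≤ β₀ / (t + 1) := by
  have h1 : (0 : ℝ) < 1 + t := by positivity
  have h2 : (0 : ℝ) < 1 + ((t + 1 : ℕ) : ℝ) := by positivity
  have h3 := Real.log_le_sub_one_of_pos (div_pos h2 h1)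
  rw [Real.log_div h2.ne' h1.ne'] at h3
  have h4 : (1 + ((t + 1 : ℕ) : ℝ)) / (1 + t) - 1 = 1 / (t + 1) := by
    push_cast
    field_simp
    ring
  rw [h4] at h3
  unfold inverseTemp
  rw [← mul_sub, ← mul_one_div β₀]
  exact mul_le_mul_of_nonneg_left h3 hβ₀

theorem exp_neg_inverseTemp_mul (β₀ c : ℝ) (t : ℕ) :
    Real.exp (-(inverseTemp β₀ t * c)) = ((t : ℝ) + 1) ^ (-(β₀ * c)) := by
  rw [Real.rpow_def_of_pos (by positivity), inverseTemp, add_comm (1 : ℝ)]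
  congr 1
  ring

theorem modifiedGibbs_mem_rowStochastic {N : ℕ} (hN : 0 < N) (h : Config N → ℝ) (β₀ : ℝ) (t : ℕ) :
    modifiedGibbs h β₀ t ∈ Matrix.rowStochastic ℝ (Config N) :=
  gibbsMatrix_mem_rowStochastic hN h _

/-- Updating the sensors one after the other reaches every configuration in `N` steps. -/
theorem le_transition_modifiedGibbs {N : ℕ} (hN : 0 < N) (h : Config N → ℝ) {β₀ : ℝ}
    (hβ₀ : 0 ≤ β₀) (n : ℕ) (x y : Config N) :
    ((2 * N : ℝ) ^ N)⁻¹ * ((n : ℝ) + (N + 1)) ^ (-(β₀ * N * costSpread h)) ≤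
      transition (modifiedGibbs h β₀) n (n + N) x y := by
  -- The last step of the window runs at `β(n + N)`, its largest inverse temperature, so `c` bounds
  -- every step.
  set c : ℝ := Real.exp (-(inverseTemp β₀ (n + N) * costSpread h)) / (2 * N) with hc
  have hc0 : 0 ≤ c := by positivity
  have step : ∀ k ≤ N, c ^ k ≤ transition (modifiedGibbs h β₀) n (n + k) x
      (fun i => if i.1 < k then y i else x i) := by
    intro k hk
    induction k with
    | zero => simp [transition_self]
    | succ k ih =>
      set z : Config N := fun i => if i.1 < k then y i else x i with hz
      have hupd : (fun i : Fin N => if i.1 < k + 1 then y i else x i) =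
          Function.update z ⟨k, hk⟩ (y ⟨k, hk⟩) := by
        ext i
        by_cases hi : i = ⟨k, hk⟩
        · subst hi
          simp
        · have : i.1 ≠ k := fun e => hi (Fin.ext e)
          have h1 : i.1 < k + 1 ↔ i.1 < k := by omega
          simp [Function.update_of_ne hi, hz, h1]
      rw [hupd, ← add_assoc, transition_succ _ (Nat.le_add_right n k), Matrix.mul_apply, pow_succ]
      refine le_trans ?_ (Finset.single_le_sum (fun w _ => mul_nonneg
        (Matrix.nonneg_of_mem_rowStochastic
          (transition_mem_rowStochastic (modifiedGibbs_mem_rowStochastic hN h β₀) _ _))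
        (Matrix.nonneg_of_mem_rowStochastic (modifiedGibbs_mem_rowStochastic hN h β₀ _)))
        (Finset.mem_univ z))
      have hge : c ≤ modifiedGibbs h β₀ (n + k) z (Function.update z ⟨k, hk⟩ (y ⟨k, hk⟩)) := by
        refine le_trans ?_ (le_gibbsMatrix_update h (inverseTemp_nonneg hβ₀ _) z _ _)
        rw [hc]
        have h1 : inverseTemp β₀ (n + k + 1) ≤ inverseTemp β₀ (n + N) :=
          inverseTemp_mono hβ₀ (by omega)
        have h2 := mul_le_mul_of_nonneg_right h1 (costSpread_nonneg h)
        gcongr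
      exact mul_le_mul (ih (by omega)) hge hc0 (le_trans (pow_nonneg hc0 k) (ih (by omega)))
  have hfin := step N le_rfl
  simp only [Fin.is_lt, if_true] at hfin
  -- The logarithmic schedule turns `c ^ N` into a power of `n + N + 1` with exponent `-β₀ N Δ`.
  refine le_trans (le_of_eq ?_) hfin
  rw [hc, exp_neg_inverseTemp_mul, div_pow, ← Real.rpow_natCast (_ ^ _), ← Real.rpow_mul
    (by positivity), inv_mul_eq_div]
  push_cast
  rw [add_assoc]
  congr 2
  ring

theorem stronglyErgodicTo_modifiedGibbs {N : ℕ} (hN : 0 < N) (h : Config N → ℝ) {β₀ : ℝ}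
    (hβ₀ : 0 < β₀) (hβ₀' : β₀ * N * costSpread h < 1) :
    StronglyErgodicTo (modifiedGibbs h β₀) (argminLaw h) := by
  refine stronglyErgodicTo_of_minorization (modifiedGibbs_mem_rowStochastic hN h β₀)
    (ρ := fun n => gibbsLaw h (inverseTemp β₀ (n + 1))) (D := 2 * (β₀ * costSpread h))
    (fun n => gibbsLaw_mem_stdSimplex h _) (fun n => gibbsLaw_vecMul_gibbsMatrix hN h _)
    (fun n => ?_)
    (fun x => (tendsto_gibbsLaw h x).comp
      ((tendsto_inverseTemp hβ₀).comp (tendsto_add_atTop_nat 1)))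
    hN (κ := ((2 * N : ℝ) ^ N)⁻¹) (K := N + 1) (by positivity)
    (le_add_of_nonneg_left (Nat.cast_nonneg N)) hβ₀' (y₀ := fun _ => true)
    (fun n x => le_transition_modifiedGibbs hN h hβ₀.le n x _)
  refine (sum_abs_gibbsLaw_sub_le h (inverseTemp_mono hβ₀.le (Nat.le_succ (n + 1)))).trans ?_
  rw [mul_div_assoc, mul_div_right_comm]
  have h1 := inverseTemp_succ_sub_le hβ₀.le (n + 1)
  have h2 : β₀ / (((n + 1 : ℕ) : ℝ) + 1) ≤ β₀ / ((n : ℝ) + 1) :=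
    div_le_div_of_nonneg_left hβ₀.le (by positivity) (by push_cast; linarith)
  have h3 := mul_le_mul_of_nonneg_right (h1.trans h2) (costSpread_nonneg h)
  linarith

theorem mainTheorem1 {N : ℕ} (hN : 0 < N)
    {Ω : Type*} [MeasurableSpace Ω] (P : Measure Ω) [IsProbabilityMeasure P]
    {E : Fin N → Type*} [∀ k, MeasurableSpace (E k)]
    (X : (k : Fin N) → Ω → E k) (hX : ∀ k, Measurable (X k))
    (est : Estimator E) (hest : ∀ B, Measurable (est B))
    (d : Config N → (k : Fin N) → E k → E k → ℝ)
    (hd : ∀ B k, Integrable (fun ω => d B k (X k ω) (estimate X est B k ω)) P)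
    (lam : ℝ) (h : Config N → ℝ) (hh : h = networkCost P X est d lam)
    (β₀ : ℝ) (hβ₀ : 0 < β₀) (hβ₀' : β₀ * N * costSpread h < 1) :
    StronglyErgodic (modifiedGibbs h β₀) ∧
    (∀ π : Config N → ℝ, StronglyErgodicTo (modifiedGibbs h β₀) π →
      ∑ A ∈ argminSet h, π A = 1) ∧
    (∀ (Ω' : Type*) [MeasurableSpace Ω'] (P' : Measure Ω') [IsProbabilityMeasure P']
      (B : ℕ → Ω' → Config N), IsMarkovChain P' B (modifiedGibbs h β₀) →
      Tendsto (fun t => ∑ A ∈ argminSet h, P'.real {ω | B t ω = A}) atTop (𝓝 1)) := by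
  have hQ := modifiedGibbs_mem_rowStochastic hN h β₀
  have herg := stronglyErgodicTo_modifiedGibbs hN h hβ₀ hβ₀'
  refine ⟨⟨argminLaw h, herg⟩, fun π hπ => ?_, fun Ω' _ P' _ B hB => ?_⟩
  -- Any initial law would do: both candidate limits are limits of the same sequence.
  · have hμ := gibbsLaw_mem_stdSimplex h 0
    have : π = argminLaw h := funext fun A =>
      tendsto_nhds_unique (hπ.tendsto_vecMul hQ hμ 0 A) (herg.tendsto_vecMul hQ hμ 0 A)
    rw [this, sum_argminSet_argminLaw]
  · rw [← sum_argminSet_argminLaw h]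
    refine tendsto_finsetSum _ fun A _ => ?_
    have hlaw : ∀ t, P'.real {ω | B t ω = A} =
        Matrix.vecMul (fun y => P'.real {ω | B 0 ω = y}) (transition (modifiedGibbs h β₀) 0 t) A :=
      fun t => congrFun (hB.law_eq_vecMul_transition t) A
    simp only [hlaw]
    exact herg.tendsto_vecMul hQ (measureReal_eq_mem_stdSimplex (hB.1 0)) 0 A
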